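/- Let $N\ge 0$ and, for $\varphi\in\mathbb R$, let $U_\varphi=|0\rangle\langle 0|+e^{i\varphi}|1\rangle\langle 1|$ be the qubit phase gate. All systems are finite-dimensional. An *$N$-use storing network* prepares a fixed state of a qubit and an ancilla, and then applies $N$ times in turn the gate $U_\varphi$ to the qubit followed by a quantum channel (completely positive, trace preserving, independent of $\varphi$) on qubit and ancilla; the ancillas are arbitrary and may change from step to step, and the output $\rho_\varphi$ of the last channel is a state of a memory $M$ (for $N=0$ the network just prepares a fixed state of $M$). A *parallel* storage applies $U_\varphi^{\otimes N}$ to $N$ qubits that share a fixed state with an ancilla, followed by a channel to a memory $M$. A *retrieving instrument* is a pair $\{\mathcal R_s,\mathcal R_f\}$ of completely positive maps from operators on $\mathbb C^2\otimes M$ to operators on $\mathbb C^2$ whose sum is trace preserving. Storage and retrieval is *exact on success, with success probability $\lambda$*, if $$\mathcal R_s(\xi\otimes\rho_\varphi)=\lambda\,U_\varphi\,\xi\,U_\varphi^\dagger\qquad\text{for all }\varphi\in\mathbb R\text{ and all qubit states }\xi,$$ with $\lambda$ independent of $\varphi$ and $\xi$. **Theorem.** The largest success probability $\lambda$ of exact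 probabilistic storage and retrieval of $U_\varphi$, over all $N$-use storing networks and all retrieving instruments, exists and equals $\frac{N}{N+1}$. The same holds with parallel storages in place of storing networks. The maximum is attained by the following protocol. For $t=0,\dots,N$ let $v_t\in(\mathbb C^2)^{\otimes N}$ be any unit vector with $U_\varphi^{\otimes N}v_t=e^{it\varphi}v_t$ for all $\varphi$ (such vectors exist, e.g. computational basis vectors with $t$ ones). Apply $U_\varphi^{\otimes N}$ to $\frac1{\sqrt{N+1}}\sum_{t=0}^N v_t$, and then the channel $X\mapsto WXW^\dagger+\mathrm{Tr}\big(X(I-W^\dagger W)\big)\,\tau$ to an $(N+1)$-dimensional qudit, where $W=\sum_t|t\rangle\langle v_t|$ and $\tau$ is any fixed qudit state. This is a parallel storage, and the stored states are also those of an $N$-use storing network. To retrieve, apply the controlled shift-down gate $|c\rangle\otimes|t\rangle\mapsto|c\rangle\otimes|t-c \bmod (N+1)\rangle$ to the input qubit (control) and the qudit, and measure the qudit in its computational basis; every outcome other than $t=N$ is a success. This protocol is exact on success, with success probability $\frac{N}{N+1}$ for every $\varphi$. -/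

import Mathlib

open scoped Kronecker ComplexOrder Matrix

noncomputable section

namespace PhaseGatePSR

/-! A finite-dimensional quantum system is a finite type `m` that labels an orthonormal basis of its
Hilbert space; operators on it are matrices in `Matrix m m ℂ`. A composite system is a product. -/

/-- Density operators: positive semidefinite, of unit trace. -/
def IsState {m : Type} [Fintype m] (ρ : Matrix m m ℂ) : Prop :=
  ρ.PosSemidef ∧ ρ.trace = 1

/-- The map `Φ ⊗ id` on operators of the composite of `m` with a `k`-dimensional reference system. -/
def ampliation {m n : Type} (Φ : Matrix m m ℂ →ₗ[ℂ] Matrix n n ℂ) (k : ℕ)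
    (X : Matrix (m × Fin k) (m × Fin k) ℂ) : Matrix (n × Fin k) (n × Fin k) ℂ :=
  Matrix.of fun p q => Φ (Matrix.of fun i j => X (i, p.2) (j, q.2)) p.1 q.1

/-- Complete positivity: `Φ ⊗ id` preserves positivity for every finite reference system. -/
def IsCompletelyPositive {m n : Type} (Φ : Matrix m m ℂ →ₗ[ℂ] Matrix n n ℂ) : Prop :=
  ∀ (k : ℕ) (X : Matrix (m × Fin k) (m × Fin k) ℂ), X.PosSemidef → (ampliation Φ k X).PosSemidef

/-- Quantum channels: completely positive and trace preserving. -/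
def IsChannel {m n : Type} [Fintype m] [Fintype n]
    (Φ : Matrix m m ℂ →ₗ[ℂ] Matrix n n ℂ) : Prop :=
  IsCompletelyPositive Φ ∧ ∀ X, (Φ X).trace = X.trace

/-- Two-outcome quantum instruments: two completely positive maps (success and failure) whose sum
is trace preserving. -/
def IsInstrument {m n : Type} [Fintype m] [Fintype n]
    (Rs Rf : Matrix m m ℂ →ₗ[ℂ] Matrix n n ℂ) : Prop :=
  IsCompletelyPositive Rs ∧ IsCompletelyPositive Rf ∧ ∀ X, ((Rs + Rf) X).trace = X.trace

/-- The map `X ↦ K X K†`. -/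
def conjMap {m n : Type} [Fintype m] (K : Matrix n m ℂ) :
    Matrix m m ℂ →ₗ[ℂ] Matrix n n ℂ where
  toFun X := K * X * Kᴴ
  map_add' X Y := by rw [Matrix.mul_add, Matrix.add_mul]
  map_smul' c X := by simp

/-- The qubit phase gate `|0⟩⟨0| + e^{iφ} |1⟩⟨1|`. -/
def phaseGate (φ : ℝ) : Matrix (Fin 2) (Fin 2) ℂ :=
  Matrix.diagonal ![1, Complex.exp (Complex.I * φ)]

/-- The gate `U_φ^{⊗N}` on `N` qubits; the computational basis is labelled by strings
`Fin N → Fin 2`. -/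
def phaseGatePow (N : ℕ) (φ : ℝ) : Matrix (Fin N → Fin 2) (Fin N → Fin 2) ℂ :=
  Matrix.of fun x y => ∏ i, phaseGate φ (x i) (y i)

/-- `AdaptiveStorage N σ`: the family of states `σ φ` of the memory `M` is what some storing network
produces out of `N` uses of the gate `U_φ`. A network with no use of the gate prepares a fixed
state. A network with `N + 1` uses consists of a network with `N` uses whose output is a qubit and an
ancilla `A`, the next use of the gate on that qubit, and a channel that does not depend on `φ`.
The ancillas are arbitrary and may vary from step to step. -/
inductive AdaptiveStorage : ℕ → ∀ {M : Type} [Fintype M] [DecidableEq M],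
    (ℝ → Matrix M M ℂ) → Prop
  | prepare {M : Type} [Fintype M] [DecidableEq M] (ρ : Matrix M M ℂ) (hρ : IsState ρ) :
      AdaptiveStorage 0 (fun _ => ρ)
  | use {N : ℕ} {A M : Type} [Fintype A] [DecidableEq A] [Fintype M] [DecidableEq M]
      (σ : ℝ → Matrix (Fin 2 × A) (Fin 2 × A) ℂ)
      (Φ : Matrix (Fin 2 × A) (Fin 2 × A) ℂ →ₗ[ℂ] Matrix M M ℂ)
      (hσ : AdaptiveStorage N σ) (hΦ : IsChannel Φ) :
      AdaptiveStorage (N + 1)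
        (fun φ => Φ (conjMap (phaseGate φ ⊗ₖ (1 : Matrix A A ℂ)) (σ φ)))

/-- `ParallelStorage N σ`: the `N` gates act in parallel on `N` qubits that share a joint state with
some ancilla `A`; a channel then maps everything to the memory `M`. -/
def ParallelStorage (N : ℕ) {M : Type} [Fintype M] (σ : ℝ → Matrix M M ℂ) : Prop :=
  ∃ (A : Type) (_ : Fintype A) (_ : DecidableEq A)
    (ρ : Matrix ((Fin N → Fin 2) × A) ((Fin N → Fin 2) × A) ℂ)
    (Φ : Matrix ((Fin N → Fin 2) × A) ((Fin N → Fin 2) × A) ℂ →ₗ[ℂ] Matrix M M ℂ),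
    IsState ρ ∧ IsChannel Φ ∧
      ∀ φ, σ φ = Φ (conjMap (phaseGatePow N φ ⊗ₖ (1 : Matrix A A ℂ)) ρ)

/-- The instrument `(Rs, Rf)` retrieves `U_φ` from the stored states `σ φ` exactly, with success
probability `p` for every `φ`: on success the input `ξ` is mapped to `p U_φ ξ U_φ†`. -/
def RetrievesWithProbability {M : Type} [Fintype M] (σ : ℝ → Matrix M M ℂ)
    (Rs Rf : Matrix (Fin 2 × M) (Fin 2 × M) ℂ →ₗ[ℂ] Matrix (Fin 2) (Fin 2) ℂ) (p : ℝ) : Prop :=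
  IsInstrument Rs Rf ∧ ∀ (φ : ℝ) (ξ : Matrix (Fin 2) (Fin 2) ℂ), IsState ξ →
    Rs (ξ ⊗ₖ σ φ) = (p : ℂ) • (phaseGate φ * ξ * (phaseGate φ)ᴴ)

/-- All success probabilities of exact retrieval after `N` uses of the gate in any storing network. -/
def adaptiveSuccessProbabilities (N : ℕ) : Set ℝ :=
  {p | ∃ (M : Type) (_ : Fintype M) (_ : DecidableEq M) (σ : ℝ → Matrix M M ℂ)
    (Rs Rf : Matrix (Fin 2 × M) (Fin 2 × M) ℂ →ₗ[ℂ] Matrix (Fin 2) (Fin 2) ℂ),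
    AdaptiveStorage N σ ∧ RetrievesWithProbability σ Rs Rf p}

/-- All success probabilities of exact retrieval after `N` parallel uses of the gate. -/
def parallelSuccessProbabilities (N : ℕ) : Set ℝ :=
  {p | ∃ (M : Type) (_ : Fintype M) (σ : ℝ → Matrix M M ℂ)
    (Rs Rf : Matrix (Fin 2 × M) (Fin 2 × M) ℂ →ₗ[ℂ] Matrix (Fin 2) (Fin 2) ℂ),
    ParallelStorage N σ ∧ RetrievesWithProbability σ Rs Rf p}

/-! The explicit protocol. -/

/-- `v t` is a unit vector of `N` qubits that carries the irreducible representation `e^{itφ}` of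
`U(1)` inside `U_φ^{⊗N}`, for each `t = 0, …, N` (e.g. a computational basis vector with `t` ones). -/
def IsIrrepFamily (N : ℕ) (v : Fin (N + 1) → (Fin N → Fin 2) → ℂ) : Prop :=
  ∀ t, v t ⬝ᵥ star (v t) = 1 ∧
    ∀ φ : ℝ, phaseGatePow N φ *ᵥ v t = Complex.exp (Complex.I * ((t : ℕ) * φ)) • v t

/-- The uniform superposition `(N + 1)^{-1/2} ∑ₜ v t` over the irreducible representations. -/
def uniformSuperposition (N : ℕ) (v : Fin (N + 1) → (Fin N → Fin 2) → ℂ) :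
    (Fin N → Fin 2) → ℂ :=
  ∑ t, ((1 / Real.sqrt (N + 1) : ℝ) : ℂ) • v t

/-- The operator `∑ₜ |t⟩⟨v t|` from `N` qubits to the `(N + 1)`-dimensional qudit. -/
def quditCoords (N : ℕ) (v : Fin (N + 1) → (Fin N → Fin 2) → ℂ) :
    Matrix (Fin (N + 1)) (Fin N → Fin 2) ℂ :=
  Matrix.of fun t x => star (v t x)

/-- The map that sends the span of the vectors `v t` to the qudit by `v t ↦ |t⟩`, and replaces the
state by `τ` on the orthogonal complement: `X ↦ W X W† + Tr (X (1 - W† W)) τ` with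
`W = ∑ₜ |t⟩⟨v t|`. -/
def compressToQudit (N : ℕ) (v : Fin (N + 1) → (Fin N → Fin 2) → ℂ)
    (τ : Matrix (Fin (N + 1)) (Fin (N + 1)) ℂ) :
    Matrix (Fin N → Fin 2) (Fin N → Fin 2) ℂ →ₗ[ℂ] Matrix (Fin (N + 1)) (Fin (N + 1)) ℂ :=
  conjMap (quditCoords N v) +
    ((Matrix.traceLinearMap (Fin N → Fin 2) ℂ ℂ) ∘ₗ
      (LinearMap.mulRight ℂ (1 - (quditCoords N v)ᴴ * quditCoords N v))).smulRight τ

/-- The qudit state stored by the protocol: the gates act in parallel on the uniform superposition,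
and the result is compressed to the qudit. -/
def quditStored (N : ℕ) (v : Fin (N + 1) → (Fin N → Fin 2) → ℂ)
    (τ : Matrix (Fin (N + 1)) (Fin (N + 1)) ℂ) (φ : ℝ) :
    Matrix (Fin (N + 1)) (Fin (N + 1)) ℂ :=
  compressToQudit N v τ (conjMap (phaseGatePow N φ)
    (Matrix.vecMulVec (uniformSuperposition N v) (star (uniformSuperposition N v))))

/-- The controlled shift-down gate `|c⟩|t⟩ ↦ |c⟩|t ⊖ c⟩`, with `⊖` modulo `N + 1`. -/
def controlledShiftDown (N : ℕ) :
    Matrix (Fin 2 × Fin (N + 1)) (Fin 2 × Fin (N + 1)) ℂ :=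
  Matrix.of fun p q => if p = (q.1, if q.1 = 1 then q.2 - 1 else q.2) then 1 else 0

/-- The operator `1 ⊗ ⟨t|` from qubit and qudit to the qubit. -/
def quditBra (N : ℕ) (t : Fin (N + 1)) : Matrix (Fin 2) (Fin 2 × Fin (N + 1)) ℂ :=
  Matrix.of fun c p => if p = (c, t) then 1 else 0

/-- Controlled shift-down, followed by outcome `t` in the measurement of the qudit in its
computational basis; the qudit is then discarded. -/
def shiftDownOutcome (N : ℕ) (t : Fin (N + 1)) :
    Matrix (Fin 2 × Fin (N + 1)) (Fin 2 × Fin (N + 1)) ℂ →ₗ[ℂ] Matrix (Fin 2) (Fin 2) ℂ :=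
  conjMap (quditBra N t * controlledShiftDown N)

/-- Success: any outcome other than `t = N`. -/
def shiftDownSuccess (N : ℕ) :
    Matrix (Fin 2 × Fin (N + 1)) (Fin 2 × Fin (N + 1)) ℂ →ₗ[ℂ] Matrix (Fin 2) (Fin 2) ℂ :=
  ∑ t : Fin N, shiftDownOutcome N t.castSucc

/-- Failure: outcome `t = N`. -/
def shiftDownFailure (N : ℕ) :
    Matrix (Fin 2 × Fin (N + 1)) (Fin 2 × Fin (N + 1)) ℂ →ₗ[ℂ] Matrix (Fin 2) (Fin 2) ℂ :=
  shiftDownOutcome N (Fin.last N)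

end PhaseGatePSR

end

open PhaseGatePSR

namespace PhaseGatePSR

/-! Upper bound. Each use of the gate raises the degree in `e^{iφ}` by at most one, so after `N`
uses the memory holds `∑ e^{i(s-t)φ} B_{st}` with frequencies `0, …, N` and one positive `B` of unit
trace (`IsCoherent`); this covers sequential and parallel storage alike. Complete positivity of the
success map makes `g((c,s),(d,t)) = ⟨c|Rs(|c⟩⟨d| ⊗ B_{st})|d⟩` a positive matrix. Put `a_t =
g((0,t),(0,t))`, `b_t = g((1,t),(1,t))`, `q_t = Tr B_{tt}`. Comparing Fourier coefficients in the
exactness condition gives `∑ a_t = ∑ b_t = p`, and also `∑ c_s = p` for `c_s = Re g((1,s+1),(0,s))`.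
Positivity gives `2 c_s ≤ a_s + b_{s+1}`; summing over `s < N` leaves no slack, so `a_N = b_0 = 0`
and `a_s = b_{s+1}` (`re_entry_le_of_posSemidef`, `success_le_of_shift`). As `a_t, b_t ≤ q_t`, the
number `p` is a sum of `N` terms bounded by `min (q_s, q_{s+1})`, where `∑ q_t = 1`. Omitting any
one `q_m` gives `p ≤ 1 - q_m`, and the average over `m` is `N/(N+1)` (`sum_min_le`).

Attainment. The stored vector is `∑ e^{itφ}|t⟩ / √(N+1)`. After the controlled shift, outcome `t <
N` leaves branch `c` with amplitude `e^{i(t+c)φ} / √(N+1)`, which is `U_φ` up to a global phase;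
only `t = N` wraps around and fails. -/

/-! ### Completely positive maps -/

/-- Positivity is preserved by relabelling indices and weighting them by complex coefficients. -/
theorem posSemidef_weighted_submatrix {ι κ : Type*} [Fintype ι] [Fintype κ] {B : Matrix ι ι ℂ}
    (hB : B.PosSemidef) (e : κ → ι) (w : κ → ℂ) :
    (Matrix.of fun i j => w i * B (e i) (e j) * star (w j)).PosSemidef := by
  classical
  have h := (hB.submatrix e).mul_mul_conjTranspose_same (Matrix.diagonal w)
  convert h using 1
  ext i j
  simp [Matrix.diagonal_conjTranspose, Matrix.mul_diagonal, Matrix.diagonal_mul]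

theorem IsCompletelyPositive.posSemidef_of_fintype {m n T : Type} [Fintype m] [Fintype n]
    [Fintype T] {Φ : Matrix m m ℂ →ₗ[ℂ] Matrix n n ℂ} (hΦ : IsCompletelyPositive Φ)
    {X : Matrix (m × T) (m × T) ℂ} (hX : X.PosSemidef) :
    (Matrix.of fun p q : n × T =>
      Φ (Matrix.of fun i j => X (i, p.2) (j, q.2)) p.1 q.1).PosSemidef := by
  have e := Fintype.equivFin T
  have h := hΦ (Fintype.card T) _ (hX.submatrix (fun p : m × Fin _ => (p.1, e.symm p.2)))
  convert h.submatrix (fun p : n × T => (p.1, e p.2)) using 1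
  ext p q
  simp [ampliation]

theorem IsCompletelyPositive.posSemidef {m n : Type} [Fintype m] [Fintype n]
    {Φ : Matrix m m ℂ →ₗ[ℂ] Matrix n n ℂ} (hΦ : IsCompletelyPositive Φ)
    {X : Matrix m m ℂ} (hX : X.PosSemidef) : (Φ X).PosSemidef := by
  have h := hΦ 1 _ (hX.submatrix Prod.fst)
  exact h.submatrix (fun i : n => (i, (0 : Fin 1)))

theorem isCompletelyPositive_zero {m n : Type} :
    IsCompletelyPositive (0 : Matrix m m ℂ →ₗ[ℂ] Matrix n n ℂ) := by
  intro k X _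
  convert Matrix.PosSemidef.zero using 1
  ext p q
  simp [ampliation]

theorem IsCompletelyPositive.add {m n : Type} {Φ Ψ : Matrix m m ℂ →ₗ[ℂ] Matrix n n ℂ}
    (hΦ : IsCompletelyPositive Φ) (hΨ : IsCompletelyPositive Ψ) :
    IsCompletelyPositive (Φ + Ψ) := by
  intro k X hX
  convert (hΦ k X hX).add (hΨ k X hX) using 1
  ext p q
  simp [ampliation]

theorem isCompletelyPositive_sum {m n ι : Type} (s : Finset ι)
    {Φ : ι → Matrix m m ℂ →ₗ[ℂ] Matrix n n ℂ} (h : ∀ i, IsCompletelyPositive (Φ i)) :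
    IsCompletelyPositive (∑ i ∈ s, Φ i) := by
  classical
  induction s using Finset.induction_on with
  | empty => simpa using isCompletelyPositive_zero
  | insert a s ha ih => rw [Finset.sum_insert ha]; exact (h a).add ih

theorem IsCompletelyPositive.comp {m n l : Type} {Ψ : Matrix n n ℂ →ₗ[ℂ] Matrix l l ℂ}
    {Φ : Matrix m m ℂ →ₗ[ℂ] Matrix n n ℂ} (hΨ : IsCompletelyPositive Ψ)
    (hΦ : IsCompletelyPositive Φ) : IsCompletelyPositive (Ψ ∘ₗ Φ) :=
  fun k X hX => hΨ k _ (hΦ k X hX)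

theorem isCompletelyPositive_conjMap {m n : Type} [Fintype m] [Fintype n] (K : Matrix n m ℂ) :
    IsCompletelyPositive (conjMap K) := by
  intro k X hX
  convert hX.mul_mul_conjTranspose_same (K ⊗ₖ (1 : Matrix (Fin k) (Fin k) ℂ)) using 1
  ext ⟨i, a⟩ ⟨j, b⟩
  simp [ampliation, conjMap, Matrix.mul_apply, Fintype.sum_prod_type, Matrix.one_apply,
    Matrix.conjTranspose_apply, apply_ite (starRingEnd ℂ)]

/-- The map that discards its input and prepares `τ`. -/
def replaceBy {m n : Type} [Fintype m] (τ : Matrix n n ℂ) :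
    Matrix m m ℂ →ₗ[ℂ] Matrix n n ℂ :=
  (Matrix.traceLinearMap m ℂ ℂ).smulRight τ

theorem isCompletelyPositive_replaceBy {m n : Type} [Fintype m] [Fintype n] {τ : Matrix n n ℂ}
    (hτ : τ.PosSemidef) : IsCompletelyPositive (replaceBy (m := m) τ) := by
  intro k X hX
  have h := Matrix.posSemidef_sum Finset.univ
    (fun (i : m) _ => hX.submatrix (fun a : Fin k => (i, a)))
  -- Discarding `m` leaves the partial trace of `X`, a sum of principal submatrices.
  suffices ampliation (replaceBy τ) k X =
      τ ⊗ₖ ∑ i, X.submatrix (fun a : Fin k => (i, a)) (fun a => (i, a)) from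
    this ▸ hτ.kronecker h
  ext ⟨i, a⟩ ⟨j, b⟩
  simp [ampliation, replaceBy, Matrix.trace, Matrix.sum_apply, mul_comm]

theorem IsChannel.comp {m n l : Type} [Fintype m] [Fintype n] [Fintype l]
    {Ψ : Matrix n n ℂ →ₗ[ℂ] Matrix l l ℂ} {Φ : Matrix m m ℂ →ₗ[ℂ] Matrix n n ℂ}
    (hΨ : IsChannel Ψ) (hΦ : IsChannel Φ) : IsChannel (Ψ ∘ₗ Φ) :=
  ⟨hΨ.1.comp hΦ.1, fun X => by simp [hΨ.2, hΦ.2]⟩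

theorem IsChannel.isState {m n : Type} [Fintype m] [Fintype n]
    {Φ : Matrix m m ℂ →ₗ[ℂ] Matrix n n ℂ} (hΦ : IsChannel Φ) {ρ : Matrix m m ℂ}
    (hρ : IsState ρ) : IsState (Φ ρ) :=
  ⟨hΦ.1.posSemidef hρ.1, by rw [hΦ.2, hρ.2]⟩

theorem isChannel_conjMap {m n : Type} [Fintype m] [Fintype n] [DecidableEq m] {V : Matrix n m ℂ}
    (hV : Vᴴ * V = 1) : IsChannel (conjMap V) := by
  refine ⟨isCompletelyPositive_conjMap V, fun X => ?_⟩
  simp only [conjMap, LinearMap.coe_mk, AddHom.coe_mk]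
  rw [Matrix.trace_mul_comm, ← Matrix.mul_assoc, hV, Matrix.one_mul]

/-- The channel that undoes an isometry `Wᴴ`: it compresses by the coisometry `W`, and prepares `τ`
on the orthogonal complement of the range of `Wᴴ`. -/
def compress {m n : Type} [Fintype m] [Fintype n] [DecidableEq m] (W : Matrix n m ℂ)
    (τ : Matrix n n ℂ) : Matrix m m ℂ →ₗ[ℂ] Matrix n n ℂ :=
  conjMap W + ((Matrix.traceLinearMap m ℂ ℂ) ∘ₗ
      (LinearMap.mulRight ℂ (1 - Wᴴ * W))).smulRight τ

section Compress

variable {m n : Type} [Fintype m] [Fintype n] [DecidableEq m]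

theorem compress_apply (W : Matrix n m ℂ) (τ : Matrix n n ℂ) (X : Matrix m m ℂ) :
    compress W τ X = W * X * Wᴴ + (X * (1 - Wᴴ * W)).trace • τ := by
  simp [compress, conjMap]

variable [DecidableEq n] {W : Matrix n m ℂ}

theorem complement_mul_self (hW : W * Wᴴ = 1) :
    (1 - Wᴴ * W) * (1 - Wᴴ * W) = 1 - Wᴴ * W := by
  have h : Wᴴ * W * (Wᴴ * W) = Wᴴ * W := by
    rw [Matrix.mul_assoc, ← Matrix.mul_assoc W, hW, Matrix.one_mul]
  rw [Matrix.sub_mul, Matrix.mul_sub (Wᴴ * W), h]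
  simp

/-- `Q = 1 - Wᴴ * W` is a projection, so `Tr (X Q) = Tr (Q X Q)`: the second summand is a
conjugation by `Q` followed by replacement with `τ`. -/
theorem isChannel_compress (hW : W * Wᴴ = 1) {τ : Matrix n n ℂ} (hτ : IsState τ) :
    IsChannel (compress W τ) := by
  constructor
  · have h : compress W τ = conjMap W + replaceBy τ ∘ₗ conjMap (1 - Wᴴ * W) := by
      ext1 X
      simp only [compress_apply, LinearMap.add_apply, LinearMap.comp_apply, replaceBy, conjMap,
        LinearMap.coe_mk, AddHom.coe_mk, LinearMap.smulRight_apply, Matrix.traceLinearMap_apply]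
      rw [Matrix.trace_mul_comm ((1 - Wᴴ * W) * X)]
      simp only [Matrix.conjTranspose_sub, Matrix.conjTranspose_one, Matrix.conjTranspose_mul,
        Matrix.conjTranspose_conjTranspose]
      rw [← Matrix.mul_assoc, complement_mul_self hW, Matrix.trace_mul_comm X]
    rw [h]
    exact (isCompletelyPositive_conjMap W).add
      ((isCompletelyPositive_replaceBy hτ.1).comp (isCompletelyPositive_conjMap _))
  · intro X
    rw [compress_apply, Matrix.trace_add, Matrix.trace_smul, hτ.2, Matrix.mul_sub,
      Matrix.trace_sub, Matrix.mul_assoc W, Matrix.trace_mul_comm W, ← Matrix.mul_assoc X]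
    simp

theorem compress_conjTranspose_mul_mul (hW : W * Wᴴ = 1) (τ Y : Matrix n n ℂ) :
    compress W τ (Wᴴ * Y * W) = Y := by
  have h : W * (1 - Wᴴ * W) = 0 := by
    rw [Matrix.mul_sub, ← Matrix.mul_assoc, hW]; simp
  rw [compress_apply, Matrix.mul_assoc (Wᴴ * Y) W, h, Matrix.mul_assoc W, Matrix.mul_assoc (Wᴴ * Y),
    hW, Matrix.mul_one, ← Matrix.mul_assoc, hW]
  simp

end Compress

/-! ### Storing networks -/

/-- Postprocessing is absorbed into the last channel, or into the prepared state if there is none.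
-/
theorem AdaptiveStorage.channel {N : ℕ} {M : Type} [Fintype M] [DecidableEq M]
    {σ : ℝ → Matrix M M ℂ} (hσ : AdaptiveStorage N σ) {L : Type} [Fintype L] [DecidableEq L]
    {Ψ : Matrix M M ℂ →ₗ[ℂ] Matrix L L ℂ} (hΨ : IsChannel Ψ) :
    AdaptiveStorage N (fun φ => Ψ (σ φ)) := by
  cases hσ with
  | prepare ρ hρ => exact .prepare _ (hΨ.isState hρ)
  | use σ Φ hσ hΦ => exact .use σ (Ψ ∘ₗ Φ) hσ (hΨ.comp hΦ)

theorem phaseGate_eq_diagonal (φ : ℝ) :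
    phaseGate φ = Matrix.diagonal fun c : Fin 2 => Complex.exp (Complex.I * ((c : ℕ) * φ)) := by
  unfold phaseGate
  congr 1
  ext c
  fin_cases c <;> simp

/-- One use of the gate, controlled by a binary function of the basis labels, multiplies a basis
vector `|m⟩` by `e^{i f(m) φ}`. -/
theorem AdaptiveStorage.controlledPhase {N : ℕ} {M : Type} [Fintype M] [DecidableEq M]
    {σ : ℝ → Matrix M M ℂ} (hσ : AdaptiveStorage N σ) {τ : Matrix M M ℂ} (hτ : IsState τ)
    (f : M → Fin 2) :
    AdaptiveStorage (N + 1) (fun φ =>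
      conjMap (Matrix.diagonal fun m => Complex.exp (Complex.I * ((f m : ℕ) * φ))) (σ φ)) := by
  -- `Wᴴ` is the isometry `|m⟩ ↦ |f m⟩|m⟩`, which writes the control bit on the qubit that the gate
  -- will meet. The gate preserves its range, so `compress W τ` erases the bit again.
  let W : Matrix M (Fin 2 × M) ℂ := Matrix.of fun m p => if p = (f m, m) then 1 else 0
  have hW : W * Wᴴ = 1 := by
    ext i j
    simp [W, Matrix.mul_apply, Matrix.one_apply]
    split_ifs with h <;> simp_all
  have hV : IsChannel (conjMap Wᴴ) := isChannel_conjMap (by simpa using hW)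
  have key := AdaptiveStorage.use _ (compress W τ) (hσ.channel hV) (isChannel_compress hW hτ)
  convert key using 2 with φ
  have hg : (phaseGate φ ⊗ₖ (1 : Matrix M M ℂ)) * Wᴴ =
      Wᴴ * Matrix.diagonal fun m => Complex.exp (Complex.I * ((f m : ℕ) * φ)) := by
    ext ⟨c, a⟩ m
    rw [Matrix.mul_diagonal, phaseGate_eq_diagonal, ← Matrix.diagonal_one,
      Matrix.diagonal_kronecker_diagonal, Matrix.diagonal_mul]
    by_cases h : (c, a) = (f m, m)
    · obtain ⟨rfl, rfl⟩ := Prod.mk.inj h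
      simp [W]
    · simp [W, h]
  have hg' := congrArg Matrix.conjTranspose hg
  simp only [Matrix.conjTranspose_mul _ Wᴴ, Matrix.conjTranspose_mul Wᴴ,
    Matrix.conjTranspose_conjTranspose] at hg'
  set D := Matrix.diagonal fun m => Complex.exp (Complex.I * ((f m : ℕ) * φ))
  have : conjMap (phaseGate φ ⊗ₖ (1 : Matrix M M ℂ)) (conjMap Wᴴ (σ φ)) =
      Wᴴ * (D * σ φ * Dᴴ) * W := by
    simp only [conjMap, LinearMap.coe_mk, AddHom.coe_mk, Matrix.conjTranspose_conjTranspose]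
    calc _ = ((phaseGate φ ⊗ₖ (1 : Matrix M M ℂ)) * Wᴴ) * σ φ *
          (W * (phaseGate φ ⊗ₖ (1 : Matrix M M ℂ))ᴴ) := by simp only [Matrix.mul_assoc]
      _ = _ := by rw [hg, hg']; simp only [Matrix.mul_assoc]
  rw [this, compress_conjTranspose_mul_mul hW]
  rfl

theorem adaptiveStorage_diagonal {M : Type} [Fintype M] [DecidableEq M] {ρ : Matrix M M ℂ}
    (hρ : IsState ρ) (f : ℕ → M → Fin 2) (N : ℕ) :
    AdaptiveStorage N (fun φ => conjMap (Matrix.diagonal fun m =>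
      Complex.exp (Complex.I * ((∑ k ∈ Finset.range N, (f k m : ℕ) : ℕ) * φ))) ρ) := by
  induction N with
  | zero => simpa [conjMap] using AdaptiveStorage.prepare ρ hρ
  | succ N ih =>
    convert ih.controlledPhase hρ (f N) using 2 with φ
    simp only [conjMap, LinearMap.coe_mk, AddHom.coe_mk]
    rw [← Matrix.mul_assoc, ← Matrix.mul_assoc, Matrix.mul_assoc _ (Matrix.diagonal _)ᴴ,
      ← Matrix.conjTranspose_mul, Matrix.diagonal_mul_diagonal]
    simp only [← Complex.exp_add, Finset.sum_range_succ, Nat.cast_add]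
    have : ∀ m, Complex.I * (((f N m : ℕ) : ℂ) * φ) +
        Complex.I * ((∑ k ∈ Finset.range N, (f k m : ℕ) : ℕ) * φ) =
        Complex.I * (((∑ k ∈ Finset.range N, (f k m : ℕ) : ℕ) + ((f N m : ℕ) : ℂ)) * φ) :=
      fun m => by ring
    simp only [this]

/-! ### The explicit protocol -/

/-- The number of ones in a string. -/
def weight {N : ℕ} (x : Fin N → Fin 2) : ℕ := ∑ i, (x i : ℕ)

theorem weight_lt {N : ℕ} (x : Fin N → Fin 2) : weight x < N + 1 := by
  have h : weight x ≤ ∑ _i : Fin N, 1 :=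
    Finset.sum_le_sum fun i _ => Nat.lt_succ_iff.mp (x i).isLt
  simp at h
  omega

theorem phaseGatePow_eq_diagonal (N : ℕ) (φ : ℝ) :
    phaseGatePow N φ = Matrix.diagonal fun x => Complex.exp (Complex.I * ((weight x : ℕ) * φ)) := by
  ext x y
  rw [phaseGatePow, Matrix.of_apply, phaseGate_eq_diagonal]
  by_cases h : x = y
  · subst h
    simp [← Complex.exp_sum, weight, Finset.mul_sum, Finset.sum_mul]
  · obtain ⟨i, hi⟩ := Function.ne_iff.mp h
    rw [Matrix.diagonal_apply_ne _ h]
    exact Finset.prod_eq_zero (Finset.mem_univ i) (Matrix.diagonal_apply_ne _ hi)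

/-- Since `π` is irrational, the single angle `φ = 1` separates all frequencies. -/
theorem exp_I_natCast_injective {m n : ℕ}
    (h : Complex.exp (Complex.I * m) = Complex.exp (Complex.I * n)) : m = n := by
  obtain ⟨k, hk⟩ := Complex.exp_eq_exp_iff_exists_int.mp h
  have h1 : (m : ℂ) = n + k * (2 * Real.pi) := by
    apply mul_left_cancel₀ Complex.I_ne_zero
    rw [hk]; ring
  have h2 : (m : ℝ) = n + k * (2 * Real.pi) := by exact_mod_cast h1
  by_cases hk0 : k = 0
  · subst hk0
    simpa using h2
  · exfalso
    refine irrational_pi ⟨((m : ℚ) - n) / (2 * k), ?_⟩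
    have : (k : ℝ) ≠ 0 := by exact_mod_cast hk0
    push_cast
    field_simp
    linarith

theorem exists_isIrrepFamily (N : ℕ) :
    ∃ v : Fin (N + 1) → (Fin N → Fin 2) → ℂ, IsIrrepFamily N v := by
  refine ⟨fun t => Pi.single (fun i => if (i : ℕ) < t then 1 else 0) 1, fun t => ⟨?_, fun φ => ?_⟩⟩
  · simp [dotProduct, Pi.single_apply, apply_ite]
  · have hw : weight (fun i : Fin N => if (i : ℕ) < t then (1 : Fin 2) else 0) = t := by
      simp only [weight, apply_ite Fin.val, Fin.val_one, Fin.val_zero]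
      rw [Fin.sum_univ_eq_sum_range (fun i => if i < (t : ℕ) then 1 else 0) N,
        Finset.sum_ite, Finset.sum_const_zero, add_zero, Finset.sum_const, smul_eq_mul, mul_one]
      convert Finset.card_range (t : ℕ) using 2
      ext i
      simp
      omega
    rw [phaseGatePow_eq_diagonal]
    ext x
    rw [Matrix.mulVec_diagonal]
    by_cases hx : x = fun i : Fin N => if (i : ℕ) < t then (1 : Fin 2) else 0
    · subst hx
      simp [hw]
    · simp [hx]

theorem IsIrrepFamily.eq_zero_of_weight_ne {N : ℕ} {v : Fin (N + 1) → (Fin N → Fin 2) → ℂ}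
    (hv : IsIrrepFamily N v) {t : Fin (N + 1)} {x : Fin N → Fin 2} (h : weight x ≠ t) :
    v t x = 0 := by
  have h1 := congrFun ((hv t).2 1) x
  rw [phaseGatePow_eq_diagonal, Matrix.mulVec_diagonal, Pi.smul_apply, smul_eq_mul] at h1
  by_contra h0
  exact h (exp_I_natCast_injective (by simpa using mul_right_cancel₀ h0 h1))

/-- Vectors with different `t` are supported on strings of different weight, hence orthogonal. -/
theorem IsIrrepFamily.quditCoords_mul_conjTranspose {N : ℕ}
    {v : Fin (N + 1) → (Fin N → Fin 2) → ℂ} (hv : IsIrrepFamily N v) :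
    quditCoords N v * (quditCoords N v)ᴴ = 1 := by
  ext s t
  rw [Matrix.mul_apply]
  by_cases h : s = t
  · subst h
    have h1 := (hv s).1
    rw [dotProduct] at h1
    simpa [quditCoords, mul_comm] using h1
  · rw [Matrix.one_apply_ne h]
    refine Finset.sum_eq_zero fun x _ => ?_
    by_cases hx : weight x = s
    · have : v t x = 0 := hv.eq_zero_of_weight_ne (fun h' => h (Fin.ext (hx.symm.trans h')))
      simp [quditCoords, this]
    · simp [quditCoords, hv.eq_zero_of_weight_ne hx]

/-- The amplitudes `e^{itφ} / √(N + 1)` of the stored qudit state. -/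
noncomputable def storedVec (N : ℕ) (φ : ℝ) (t : Fin (N + 1)) : ℂ :=
  Complex.exp (Complex.I * ((t : ℕ) * φ)) * ((1 / Real.sqrt (N + 1) : ℝ) : ℂ)

theorem norm_sq_coefficient (N : ℕ) :
    ((1 / Real.sqrt (N + 1) : ℝ) : ℂ) * ((1 / Real.sqrt (N + 1) : ℝ) : ℂ) = 1 / (N + 1) := by
  have : (0 : ℝ) ≤ (N : ℝ) + 1 := by positivity
  rw [← Complex.ofReal_mul, div_mul_div_comm, Real.mul_self_sqrt this]
  push_cast
  ring

theorem storedVec_mul_star (N : ℕ) (φ : ℝ) (s t : Fin (N + 1)) :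
    storedVec N φ s * star (storedVec N φ t) =
      1 / (N + 1) * Complex.exp (Complex.I * (((s : ℕ) - (t : ℕ)) * φ)) := by
  rw [storedVec, storedVec, star_mul', ← norm_sq_coefficient]
  have : star (Complex.exp (Complex.I * ((t : ℕ) * φ))) =
      Complex.exp (-(Complex.I * ((t : ℕ) * φ))) := by
    rw [Complex.star_def, ← Complex.exp_conj]; simp
  rw [this, sub_mul, mul_sub, sub_eq_add_neg (Complex.I * _), Complex.exp_add]
  simp only [Complex.star_def, Complex.conj_ofReal]
  ring

theorem phaseGatePow_mulVec_uniformSuperposition {N : ℕ}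
    {v : Fin (N + 1) → (Fin N → Fin 2) → ℂ} (hv : IsIrrepFamily N v) (φ : ℝ) :
    phaseGatePow N φ *ᵥ uniformSuperposition N v = (quditCoords N v)ᴴ *ᵥ storedVec N φ := by
  rw [uniformSuperposition, Matrix.mulVec_sum]
  simp only [Matrix.mulVec_smul, (hv _).2]
  ext x
  simp [Matrix.mulVec, dotProduct, quditCoords, storedVec, Finset.sum_apply]
  refine Finset.sum_congr rfl fun t _ => ?_
  ring

theorem conjMap_vecMulVec {m n : Type} [Fintype m] (K : Matrix n m ℂ) (u : m → ℂ) :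
    conjMap K (Matrix.vecMulVec u (star u)) = Matrix.vecMulVec (K *ᵥ u) (star (K *ᵥ u)) := by
  simp only [conjMap, LinearMap.coe_mk, AddHom.coe_mk]
  rw [Matrix.mul_vecMulVec, Matrix.vecMulVec_mul, Matrix.star_mulVec]

/-- The gates keep the superposition in the span of the `v t`, where the compression inverts `Wᴴ`;
so neither `v` nor `τ` influences the result. -/
theorem quditStored_eq {N : ℕ} {v : Fin (N + 1) → (Fin N → Fin 2) → ℂ} (hv : IsIrrepFamily N v)
    (τ : Matrix (Fin (N + 1)) (Fin (N + 1)) ℂ) (φ : ℝ) :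
    quditStored N v τ φ = Matrix.vecMulVec (storedVec N φ) (star (storedVec N φ)) := by
  rw [quditStored, conjMap_vecMulVec, phaseGatePow_mulVec_uniformSuperposition hv,
    ← conjMap_vecMulVec]
  have h := compress_conjTranspose_mul_mul hv.quditCoords_mul_conjTranspose τ
    (Matrix.vecMulVec (storedVec N φ) (star (storedVec N φ)))
  simp only [conjMap, LinearMap.coe_mk, AddHom.coe_mk, Matrix.conjTranspose_conjTranspose]
  exact h

theorem isState_vecMulVec {m : Type} [Fintype m] {u : m → ℂ} (hu : u ⬝ᵥ star u = 1) :
    IsState (Matrix.vecMulVec u (star u)) :=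
  ⟨Matrix.posSemidef_vecMulVec_self_star u, by rw [Matrix.trace_vecMulVec, hu]⟩

theorem storedVec_dotProduct_star (N : ℕ) (φ : ℝ) :
    storedVec N φ ⬝ᵥ star (storedVec N φ) = 1 := by
  have : (N : ℂ) + 1 ≠ 0 := by exact_mod_cast N.succ_ne_zero
  rw [dotProduct]
  simp only [Pi.star_apply, storedVec_mul_star]
  simp
  field_simp

/-- The network starts from the stored vector at `φ = 0` and controls use `k` by the bit `k < t`. As
`t ≤ N`, exactly `t` of the `N` uses act on `|t⟩`. -/
theorem adaptiveStorage_quditStored {N : ℕ} {v : Fin (N + 1) → (Fin N → Fin 2) → ℂ}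
    (hv : IsIrrepFamily N v) (τ : Matrix (Fin (N + 1)) (Fin (N + 1)) ℂ) :
    AdaptiveStorage N (quditStored N v τ) := by
  convert adaptiveStorage_diagonal (isState_vecMulVec (storedVec_dotProduct_star N 0))
    (fun k t => if k < (t : ℕ) then 1 else 0) N using 2 with φ
  rw [quditStored_eq hv, conjMap_vecMulVec]
  have : storedVec N φ = (Matrix.diagonal fun t : Fin (N + 1) =>
      Complex.exp (Complex.I * ((∑ k ∈ Finset.range N,
        ((if k < (t : ℕ) then 1 else 0 : Fin 2) : ℕ) : ℕ) * φ))) *ᵥ storedVec N 0 := by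
    ext t
    have hw : ∑ k ∈ Finset.range N, ((if k < (t : ℕ) then 1 else 0 : Fin 2) : ℕ) = t := by
      simp only [apply_ite Fin.val, Fin.val_one, Fin.val_zero]
      rw [Finset.sum_ite, Finset.sum_const_zero, add_zero, Finset.sum_const, smul_eq_mul, mul_one]
      convert Finset.card_range (t : ℕ) using 2
      ext i
      simp
      omega
    rw [Matrix.mulVec_diagonal, hw]
    simp [storedVec]
  rw [this]

theorem uniformSuperposition_dotProduct_star {N : ℕ} {v : Fin (N + 1) → (Fin N → Fin 2) → ℂ}
    (hv : IsIrrepFamily N v) : uniformSuperposition N v ⬝ᵥ star (uniformSuperposition N v) = 1 := by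
  -- At `φ = 0` the gates are trivial, which exhibits the superposition as an isometric image of
  -- `storedVec N 0`.
  have h := phaseGatePow_mulVec_uniformSuperposition hv 0
  rw [phaseGatePow_eq_diagonal] at h
  simp only [Complex.ofReal_zero, mul_zero, Complex.exp_zero, Matrix.diagonal_one,
    Matrix.one_mulVec] at h
  rw [h, Matrix.star_mulVec, Matrix.conjTranspose_conjTranspose, dotProduct_comm,
    ← Matrix.dotProduct_mulVec, Matrix.mulVec_mulVec, hv.quditCoords_mul_conjTranspose,
    Matrix.one_mulVec, dotProduct_comm, storedVec_dotProduct_star]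

/-- A one-dimensional ancilla is attached by the unitary `V` and removed by its adjoint. -/
theorem parallelStorage_of_conjMap {N : ℕ} {M : Type} [Fintype M]
    {ρ : Matrix (Fin N → Fin 2) (Fin N → Fin 2) ℂ} (hρ : IsState ρ)
    {Φ : Matrix (Fin N → Fin 2) (Fin N → Fin 2) ℂ →ₗ[ℂ] Matrix M M ℂ} (hΦ : IsChannel Φ) :
    ParallelStorage N (fun φ => Φ (conjMap (phaseGatePow N φ) ρ)) := by
  let V : Matrix ((Fin N → Fin 2) × Unit) (Fin N → Fin 2) ℂ :=
    (1 : Matrix (Fin N → Fin 2) (Fin N → Fin 2) ℂ).submatrix Prod.fst id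
  have hV : Vᴴ * V = 1 := by
    ext i j
    by_cases h : j = i
    · subst h
      simp [V, Matrix.mul_apply, Fintype.sum_prod_type, Matrix.one_apply]
    · simp [V, Matrix.mul_apply, Fintype.sum_prod_type, Matrix.one_apply, Ne.symm h]
  have hV' : V * Vᴴ = 1 := by
    ext ⟨i, _⟩ ⟨j, _⟩
    simp [V, Matrix.mul_apply, Matrix.one_apply, eq_comm]
  refine ⟨Unit, inferInstance, inferInstance, conjMap V ρ, Φ ∘ₗ conjMap Vᴴ,
    (isChannel_conjMap hV).isState hρ, hΦ.comp (isChannel_conjMap (by simpa using hV')),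
    fun φ => ?_⟩
  have hg : Vᴴ * (phaseGatePow N φ ⊗ₖ (1 : Matrix Unit Unit ℂ)) * V = phaseGatePow N φ := by
    rw [phaseGatePow_eq_diagonal, ← Matrix.diagonal_one, Matrix.diagonal_kronecker_diagonal]
    ext i j
    by_cases h : i = j
    · subst h
      simp [V, Matrix.mul_apply, Fintype.sum_prod_type, Matrix.one_apply, Matrix.diagonal_apply]
    · simp [V, Matrix.mul_apply, Fintype.sum_prod_type, Matrix.one_apply, Matrix.diagonal_apply, h]
  have hg' := congrArg Matrix.conjTranspose hg
  simp only [conjMap, LinearMap.coe_mk, AddHom.coe_mk, LinearMap.comp_apply]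
  generalize (phaseGatePow N φ ⊗ₖ (1 : Matrix Unit Unit ℂ)) = G at hg hg' ⊢
  rw [← hg', ← hg]
  simp only [Matrix.conjTranspose_mul, Matrix.conjTranspose_conjTranspose, Matrix.mul_assoc]

theorem parallelStorage_quditStored {N : ℕ} {v : Fin (N + 1) → (Fin N → Fin 2) → ℂ}
    (hv : IsIrrepFamily N v) {τ : Matrix (Fin (N + 1)) (Fin (N + 1)) ℂ} (hτ : IsState τ) :
    ParallelStorage N (quditStored N v τ) :=
  parallelStorage_of_conjMap (isState_vecMulVec (uniformSuperposition_dotProduct_star hv))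
    (isChannel_compress hv.quditCoords_mul_conjTranspose hτ)

/-! ### The shift-down instrument -/

/-- The label `t ⊖ c` that the controlled shift-down gate produces. -/
def shiftIndex (N : ℕ) (q : Fin 2 × Fin (N + 1)) : Fin (N + 1) :=
  if q.1 = 1 then q.2 - 1 else q.2

theorem quditBra_mul_controlledShiftDown (N : ℕ) (t : Fin (N + 1)) (c : Fin 2)
    (q : Fin 2 × Fin (N + 1)) :
    (quditBra N t * controlledShiftDown N) c q = if c = q.1 ∧ t = shiftIndex N q then 1 else 0 := by
  simp [Matrix.mul_apply, quditBra, controlledShiftDown, shiftIndex, eq_comm]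
  congr

/-- The gate permutes the basis, and `|c⟩|t⟩` has the single preimage `|c⟩|t + c⟩`, with addition
modulo `N + 1`. -/
theorem shiftDownOutcome_apply (N : ℕ) (t : Fin (N + 1))
    (X : Matrix (Fin 2 × Fin (N + 1)) (Fin 2 × Fin (N + 1)) ℂ) (c d : Fin 2) :
    shiftDownOutcome N t X c d = X (c, t + if c = 1 then 1 else 0) (d, t + if d = 1 then 1 else 0) := by
  have h : ∀ q c, (c = q.1 ∧ t = shiftIndex N q) ↔ q = (c, t + if c = 1 then 1 else 0) := by
    rintro ⟨a, s⟩ c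
    simp only [Prod.mk.injEq, shiftIndex]
    constructor
    · rintro ⟨rfl, h⟩
      split_ifs at h ⊢ <;> simp [h]
    · rintro ⟨rfl, h⟩
      split_ifs at h ⊢ <;> simp [h]
  simp only [shiftDownOutcome, conjMap, LinearMap.coe_mk, AddHom.coe_mk]
  rw [Matrix.mul_apply]
  simp only [Matrix.conjTranspose_apply, Matrix.mul_apply (N := X),
    quditBra_mul_controlledShiftDown, h]
  simp

theorem sum_shiftDownOutcome_trace (N : ℕ)
    (X : Matrix (Fin 2 × Fin (N + 1)) (Fin 2 × Fin (N + 1)) ℂ) :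
    ∑ t, (shiftDownOutcome N t X).trace = X.trace := by
  simp only [Matrix.trace, Matrix.diag, shiftDownOutcome_apply]
  rw [Finset.sum_comm, Fintype.sum_prod_type]
  refine Finset.sum_congr rfl fun c _ => ?_
  exact Equiv.sum_comp (Equiv.addRight (if c = 1 then (1 : Fin (N + 1)) else 0)) (fun t => X (c, t) (c, t))

theorem isInstrument_shiftDown (N : ℕ) :
    IsInstrument (shiftDownSuccess N) (shiftDownFailure N) := by
  refine ⟨isCompletelyPositive_sum _ fun t => isCompletelyPositive_conjMap _,
    isCompletelyPositive_conjMap _, fun X => ?_⟩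
  rw [← sum_shiftDownOutcome_trace, Fin.sum_univ_castSucc, shiftDownSuccess, shiftDownFailure,
    LinearMap.add_apply, Matrix.trace_add, LinearMap.sum_apply, Matrix.trace_sum]

theorem shiftDownSuccess_kronecker_storedVec (N : ℕ) (φ : ℝ) (ξ : Matrix (Fin 2) (Fin 2) ℂ) :
    shiftDownSuccess N (ξ ⊗ₖ Matrix.vecMulVec (storedVec N φ) (star (storedVec N φ))) =
      (((N : ℝ) / ((N : ℝ) + 1) : ℝ) : ℂ) • (phaseGate φ * ξ * (phaseGate φ)ᴴ) := by
  -- For `t < N` the sum `t + c` does not wrap around. Hence the phase difference below depends on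
  -- `c` and `d` alone, and all `N` outcomes contribute equally.
  have hs : ∀ (t : Fin N) (c : Fin 2),
      ((t.castSucc + if c = 1 then 1 else 0 : Fin (N + 1)) : ℕ) = (t : ℕ) + (c : ℕ) := by
    intro t c
    fin_cases c <;> simp
  ext c d
  rw [shiftDownSuccess, LinearMap.sum_apply, Matrix.sum_apply]
  simp only [shiftDownOutcome_apply, Matrix.kroneckerMap_apply, Matrix.vecMulVec_apply,
    Pi.star_apply, storedVec_mul_star, hs]
  rw [phaseGate_eq_diagonal, Matrix.smul_apply, Matrix.diagonal_conjTranspose, Matrix.mul_diagonal,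
    Matrix.diagonal_mul, Pi.star_apply, Complex.star_def, ← Complex.exp_conj]
  have h1 : ∀ t : Fin N, ((((t : ℕ) + (c : ℕ) : ℕ) : ℂ) - (((t : ℕ) + (d : ℕ) : ℕ) : ℂ)) * φ =
      (c : ℕ) * φ - (d : ℕ) * φ := by
    intro t; push_cast; ring
  simp only [h1, Finset.sum_const, Finset.card_univ, Fintype.card_fin]
  rw [mul_sub, sub_eq_add_neg, Complex.exp_add]
  simp
  ring

theorem retrievesWithProbability_quditStored {N : ℕ} {v : Fin (N + 1) → (Fin N → Fin 2) → ℂ}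
    (hv : IsIrrepFamily N v) (τ : Matrix (Fin (N + 1)) (Fin (N + 1)) ℂ) :
    RetrievesWithProbability (quditStored N v τ) (shiftDownSuccess N) (shiftDownFailure N)
      ((N : ℝ) / ((N : ℝ) + 1)) :=
  ⟨isInstrument_shiftDown N, fun φ ξ _ => by
    rw [quditStored_eq hv, shiftDownSuccess_kronecker_storedVec]⟩

/-! ### Fourier coefficients and a linear programming bound -/

theorem integral_exp_int (n : ℤ) :
    ∫ x in (0 : ℝ)..2 * Real.pi, Complex.exp (Complex.I * (n * x)) =
      if n = 0 then 2 * (Real.pi : ℂ) else 0 := by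
  split_ifs with h
  · simp [h]
  · have hc : Complex.I * (n : ℂ) ≠ 0 := by simp [h]
    simp only [← mul_assoc]
    rw [integral_exp_mul_complex hc]
    have : Complex.I * (n : ℂ) * ((2 * Real.pi : ℝ) : ℂ) = n * (2 * Real.pi * Complex.I) := by
      push_cast; ring
    rw [this, Complex.exp_int_mul_two_pi_mul_I]
    simp

/-- The coefficients of a trigonometric polynomial are determined by its values. -/
theorem sum_coefficient_eq {ι : Type*} [Fintype ι] (f : ι → ℤ) (h : ι → ℂ) (P : ℂ) (k : ℤ)
    (H : ∀ φ : ℝ, ∑ i, Complex.exp (Complex.I * (f i * φ)) * h i =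
      P * Complex.exp (Complex.I * (k * φ))) :
    ∑ i, (if f i = k then h i else 0) = P := by
  have hpi : (2 * (Real.pi : ℂ)) ≠ 0 := by simp [Real.pi_ne_zero]
  -- Moving frequency `k` to `0` lets the integral over a period isolate the wanted terms.
  have H2 : ∀ φ : ℝ, ∑ i, Complex.exp (Complex.I * ((f i - k : ℤ) * φ)) * h i = P := by
    intro φ
    have h1 := congrArg (· * Complex.exp (-(Complex.I * (k * φ)))) (H φ)
    simp only [Finset.sum_mul, mul_assoc P, ← Complex.exp_add, add_neg_cancel, Complex.exp_zero,
      mul_one] at h1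
    rw [← h1]
    refine Finset.sum_congr rfl fun i _ => ?_
    rw [mul_right_comm, ← Complex.exp_add]
    congr 2
    push_cast; ring
  have H3 := congrArg (fun F : ℝ → ℂ => ∫ x in (0 : ℝ)..2 * Real.pi, F x) (funext H2)
  rw [intervalIntegral.integral_finsetSum
    (fun i _ => Continuous.intervalIntegrable (by fun_prop) _ _)] at H3
  simp only [intervalIntegral.integral_mul_const, integral_exp_int, sub_eq_zero,
    intervalIntegral.integral_const, sub_zero, Complex.real_smul] at H3
  apply mul_left_cancel₀ hpi
  rw [Finset.mul_sum]
  push_cast at H3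
  rw [← H3]
  refine Finset.sum_congr rfl fun i _ => ?_
  split_ifs <;> simp

theorem sum_diagonal_eq {n : ℕ} (h : Fin n → Fin n → ℂ) (P : ℂ)
    (H : ∀ φ : ℝ, ∑ s : Fin n, ∑ t : Fin n,
      Complex.exp (Complex.I * (((s : ℕ) - (t : ℕ)) * φ)) * h s t = P) :
    ∑ s, h s s = P := by
  have := sum_coefficient_eq (fun x : Fin n × Fin n => ((x.1 : ℕ) : ℤ) - ((x.2 : ℕ) : ℤ))
    (fun x => h x.1 x.2) P 0 (fun φ => by simpa [Fintype.sum_prod_type] using H φ)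
  rw [← this, Fintype.sum_prod_type]
  refine Finset.sum_congr rfl fun s _ => ?_
  simp only [sub_eq_zero, Nat.cast_inj, Fin.val_inj]
  simp

theorem sum_subdiagonal_eq {n : ℕ} (h : Fin (n + 1) → Fin (n + 1) → ℂ) (P : ℂ)
    (H : ∀ φ : ℝ, ∑ s : Fin (n + 1), ∑ t : Fin (n + 1),
      Complex.exp (Complex.I * (((s : ℕ) - (t : ℕ)) * φ)) * h s t =
      P * Complex.exp (Complex.I * φ)) :
    ∑ s : Fin n, h s.succ s.castSucc = P := by
  have := sum_coefficient_eq
    (fun x : Fin (n + 1) × Fin (n + 1) => ((x.1 : ℕ) : ℤ) - ((x.2 : ℕ) : ℤ))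
    (fun x => h x.1 x.2) P 1 (fun φ => by simpa [Fintype.sum_prod_type] using H φ)
  rw [← this, Fintype.sum_prod_type, Fin.sum_univ_succ]
  have h0 : ∑ y : Fin (n + 1),
      (if (((0 : Fin (n + 1)) : ℕ) : ℤ) - ((y : ℕ) : ℤ) = 1 then h 0 y else 0) = 0 :=
    Finset.sum_eq_zero fun y _ => if_neg (by simp; omega)
  simp only [h0, zero_add]
  refine Finset.sum_congr rfl fun s _ => ?_
  have h1 : ∀ y : Fin (n + 1), (((s.succ : ℕ) : ℤ) - ((y : ℕ) : ℤ) = 1) ↔ s.castSucc = y := by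
    intro y
    rw [Fin.ext_iff]
    simp
    omega
  simp only [h1]
  simp

/-- `m.succAbove` matches the `N` indices `s` with the `N` indices other than `m`, each `s` going to
one of its neighbours `s`, `s + 1`. This bounds the sum by `1 - q m`; then sum over `m`. -/
theorem sum_min_le {N : ℕ} (q : Fin (N + 1) → ℝ) (hq : ∑ t, q t = 1) (r : Fin N → ℝ)
    (h1 : ∀ s, r s ≤ q s.castSucc) (h2 : ∀ s, r s ≤ q s.succ) :
    ∑ s, r s ≤ (N : ℝ) / ((N : ℝ) + 1) := by
  have h : ∀ m : Fin (N + 1), ∑ s, r s ≤ 1 - q m := by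
    intro m
    rw [← hq, Fin.sum_univ_succAbove q m, add_sub_cancel_left]
    refine Finset.sum_le_sum fun s _ => ?_
    unfold Fin.succAbove
    split_ifs
    · exact h1 s
    · exact h2 s
  have h3 := Finset.sum_le_sum fun m (_ : m ∈ Finset.univ) => h m
  rw [Finset.sum_sub_distrib, hq] at h3
  simp only [Finset.sum_const, Finset.card_univ, Fintype.card_fin, nsmul_eq_mul, mul_one] at h3
  push_cast at h3
  rw [le_div_iff₀ (by positivity)]
  linarith

/-- The slacks in `hc` are nonnegative but add up to `-(a_N + b_0) ≤ 0`. All of them vanish, and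
`hc'` yields a common value `a_s = b_{s+1}` bounded by both `q_s` and `q_{s+1}`. -/
theorem success_le_of_shift {N : ℕ} {p : ℝ} {q a b : Fin (N + 1) → ℝ} {c : Fin N → ℝ}
    (hq : ∑ t, q t = 1) (ha : ∀ t, 0 ≤ a t) (hb : ∀ t, 0 ≤ b t) (haq : ∀ t, a t ≤ q t)
    (hbq : ∀ t, b t ≤ q t) (hc : ∀ s, 2 * c s ≤ a s.castSucc + b s.succ)
    (hc' : ∀ s, 2 * c s = a s.castSucc + b s.succ → a s.castSucc = b s.succ)
    (hap : ∑ t, a t = p) (hbp : ∑ t, b t = p) (hcp : ∑ s, c s = p) :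
    p ≤ (N : ℝ) / ((N : ℝ) + 1) := by
  rw [Fin.sum_univ_castSucc] at hap
  rw [Fin.sum_univ_succ] at hbp
  have hnn : ∀ s ∈ (Finset.univ : Finset (Fin N)), 0 ≤ a s.castSucc + b s.succ - 2 * c s :=
    fun s _ => sub_nonneg.mpr (hc s)
  have hsum : ∑ s : Fin N, (a s.castSucc + b s.succ - 2 * c s) = -(a (Fin.last N) + b 0) := by
    rw [Finset.sum_sub_distrib, Finset.sum_add_distrib, ← Finset.mul_sum]
    linarith
  have hge := Finset.sum_nonneg hnn
  have hl := ha (Fin.last N)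
  have hz := hb 0
  have hzero : ∑ s : Fin N, (a s.castSucc + b s.succ - 2 * c s) = 0 := by linarith
  have heq : ∀ s : Fin N, a s.castSucc = b s.succ := fun s => hc' s (by
    have := (Finset.sum_eq_zero_iff_of_nonneg hnn).mp hzero s (Finset.mem_univ s)
    linarith)
  have : p = ∑ s : Fin N, a s.castSucc := by linarith
  rw [this]
  exact sum_min_le q hq _ (fun s => haq _) (fun s => (heq s).trans_le (hbq _))

/-- Evaluate the quadratic form at `e_i - e_j`. In the equality case this vector lies in the kernel,
and rows `i` and `j` give `g i i = g i j` and `g j i = g j j`. -/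
theorem re_entry_le_of_posSemidef {ι : Type*} [Fintype ι] {g : Matrix ι ι ℂ} (hg : g.PosSemidef)
    (i j : ι) : 2 * (g j i).re ≤ (g i i).re + (g j j).re ∧
      (2 * (g j i).re = (g i i).re + (g j j).re → (g i i).re = (g j j).re) := by
  classical
  have hij : g i j = star (g j i) := (hg.isHermitian.apply i j).symm
  have hii : (g i i).im = 0 := (Complex.nonneg_iff.mp hg.diag_nonneg).2.symm
  have hjj : (g j j).im = 0 := (Complex.nonneg_iff.mp hg.diag_nonneg).2.symm
  have hmul : ∀ k, (g *ᵥ (Pi.single i 1 - Pi.single j 1)) k = g k i - g k j := by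
    intro k
    simp [Matrix.mulVec_sub]
  have hform : star (Pi.single i 1 - Pi.single j 1 : ι → ℂ) ⬝ᵥ
      (g *ᵥ (Pi.single i 1 - Pi.single j 1)) = (g i i - g i j) - (g j i - g j j) := by
    rw [star_sub, sub_dotProduct]
    simp only [← Pi.single_star, star_one, single_dotProduct, one_mul, hmul]
  have hre : ((g i i - g i j) - (g j i - g j j)).re =
      (g i i).re + (g j j).re - 2 * (g j i).re := by
    rw [hij]; simp; ring
  have him : ((g i i - g i j) - (g j i - g j j)).im = 0 := by
    rw [hij]; simp [hii, hjj]
  constructor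
  · have := hg.dotProduct_mulVec_nonneg (Pi.single i 1 - Pi.single j 1)
    rw [hform] at this
    have := (Complex.nonneg_iff.mp this).1
    rw [hre] at this
    linarith
  · intro h
    have h0 : (g i i - g i j) - (g j i - g j j) = 0 :=
      Complex.ext (by rw [hre, h]; simp) (by rw [him]; simp)
    have hz := (hg.dotProduct_mulVec_zero_iff _).mp (hform.trans h0)
    have h1 := congrArg Complex.re ((hmul i).symm.trans (congrFun hz i))
    have h2 := congrArg Complex.re ((hmul j).symm.trans (congrFun hz j))
    rw [hij] at h1
    simp at h1 h2
    linarith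

/-! ### Stored states as trigonometric polynomials -/

/-- The block `(s, t)` of an operator on a composite system. -/
def block {M T : Type} (B : Matrix (M × T) (M × T) ℂ) (s t : T) : Matrix M M ℂ :=
  Matrix.of fun i j => B (i, s) (j, t)

/-- The states `∑ e^{i(s-t)φ} B_{st}`, with `B` positive of unit trace: all coherences between `n`
frequencies are recorded in `B`. -/
def IsCoherent (n : ℕ) {M : Type} [Fintype M] (σ : ℝ → Matrix M M ℂ) : Prop :=
  ∃ B : Matrix (M × Fin n) (M × Fin n) ℂ, IsState B ∧
    ∀ φ, σ φ = ∑ s : Fin n, ∑ t : Fin n,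
      Complex.exp (Complex.I * (((s : ℕ) - (t : ℕ)) * φ)) • block B s t

/-- The channel acts block by block, so `B` becomes its image under `Φ ⊗ id`. -/
theorem IsCoherent.channel {n : ℕ} {M L : Type} [Fintype M] [Fintype L] {σ : ℝ → Matrix M M ℂ}
    (hσ : IsCoherent n σ) {Φ : Matrix M M ℂ →ₗ[ℂ] Matrix L L ℂ} (hΦ : IsChannel Φ) :
    IsCoherent n (fun φ => Φ (σ φ)) := by
  obtain ⟨B, hB, h⟩ := hσ
  refine ⟨ampliation Φ n B, ⟨hΦ.1 n B hB.1, ?_⟩, fun φ => ?_⟩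
  · have : ∀ s, ∑ i, ampliation Φ n B (i, s) (i, s) = ∑ i, B (i, s) (i, s) :=
      fun s => hΦ.2 (block B s s)
    rw [← hB.2]
    simp only [Matrix.trace, Matrix.diag, Fintype.sum_prod_type_right, this]
  · simp only [h, map_sum, map_smul]
    rfl

theorem conjMap_diagonal_apply {m : Type} [Fintype m] [DecidableEq m] (d : m → ℂ)
    (X : Matrix m m ℂ) (i j : m) :
    conjMap (Matrix.diagonal d) X i j = d i * X i j * star (d j) := by
  simp [conjMap, Matrix.diagonal_conjTranspose, Matrix.mul_diagonal, Matrix.diagonal_mul]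

theorem exp_mul_star_exp (x y : ℝ) :
    Complex.exp (Complex.I * x) * star (Complex.exp (Complex.I * y)) =
      Complex.exp (Complex.I * (x - y)) := by
  rw [Complex.star_def, ← Complex.exp_conj, ← Complex.exp_add]
  congr 1
  simp
  ring

theorem phaseGate_kronecker_one (A : Type) [DecidableEq A] (φ : ℝ) :
    phaseGate φ ⊗ₖ (1 : Matrix A A ℂ) =
      Matrix.diagonal fun p => Complex.exp (Complex.I * (((p.1 : ℕ) : ℝ) * φ : ℝ)) := by
  rw [phaseGate_eq_diagonal, ← Matrix.diagonal_one, Matrix.diagonal_kronecker_diagonal]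
  simp

/-- The frequency `s - c`, if it exists (clamped otherwise). -/
def lowerFreq {n : ℕ} : Fin 2 → Fin (n + 2) → Fin (n + 1)
  | 0 => Fin.lastCases 0 id
  | 1 => Fin.cases 0 id

/-- Whether the frequency `s - c` exists. -/
def lowerWeight {n : ℕ} : Fin 2 → Fin (n + 2) → ℂ
  | 0 => Fin.lastCases 0 (fun _ => 1)
  | 1 => Fin.cases 0 (fun _ => 1)

/-- Clamped frequencies have weight zero; the others are reindexed by `s ↦ s + c`. -/
theorem sum_lowerWeight_mul {n : ℕ} (c : Fin 2) (F : ℕ → Fin (n + 1) → ℂ) :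
    ∑ s : Fin (n + 2), lowerWeight c s * F s (lowerFreq c s) = ∑ s : Fin (n + 1), F (s + c) s := by
  fin_cases c
  · rw [Fin.sum_univ_castSucc]
    simp [lowerWeight, lowerFreq]
  · rw [Fin.sum_univ_succ]
    simp [lowerWeight, lowerFreq]

theorem star_lowerWeight {n : ℕ} (c : Fin 2) (s : Fin (n + 2)) :
    star (lowerWeight c s) = lowerWeight c s := by
  fin_cases c
  · induction s using Fin.lastCases <;> simp [lowerWeight]
  · induction s using Fin.cases <;> simp [lowerWeight]

theorem lowerWeight_mul_self {n : ℕ} (c : Fin 2) (s : Fin (n + 2)) :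
    lowerWeight c s * lowerWeight c s = lowerWeight c s := by
  fin_cases c
  · induction s using Fin.lastCases <;> simp [lowerWeight]
  · induction s using Fin.cases <;> simp [lowerWeight]

/-- The gate raises the frequency of rows with qubit label `c` by `c`. On `B` this is a relabelling
with weights `0` and `1`, which keeps positivity and trace. -/
theorem IsCoherent.phaseGate {n : ℕ} {A : Type} [Fintype A] [DecidableEq A]
    {σ : ℝ → Matrix (Fin 2 × A) (Fin 2 × A) ℂ} (hσ : IsCoherent (n + 1) σ) :
    IsCoherent (n + 2)
      (fun φ => conjMap (PhaseGatePSR.phaseGate φ ⊗ₖ (1 : Matrix A A ℂ)) (σ φ)) := by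
  obtain ⟨B, hB, h⟩ := hσ
  refine ⟨_, ⟨posSemidef_weighted_submatrix hB.1
    (fun p : (Fin 2 × A) × Fin (n + 2) => (p.1, lowerFreq p.1.1 p.2))
    (fun p => lowerWeight p.1.1 p.2), ?_⟩, fun φ => ?_⟩
  · rw [← hB.2]
    simp only [Matrix.trace, Matrix.diag, Matrix.of_apply, Fintype.sum_prod_type (α₁ := Fin 2 × A)]
    refine Finset.sum_congr rfl fun p _ => ?_
    rw [← sum_lowerWeight_mul p.1 (fun _ s => B (p, s) (p, s))]
    refine Finset.sum_congr rfl fun s _ => ?_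
    rw [star_lowerWeight, mul_right_comm, lowerWeight_mul_self]
  · ext p q
    beta_reduce
    rw [phaseGate_kronecker_one, conjMap_diagonal_apply, h]
    simp only [Matrix.sum_apply, Matrix.smul_apply, block, Matrix.of_apply, smul_eq_mul,
      star_lowerWeight]
    rw [mul_right_comm, exp_mul_star_exp]
    have hF : ∀ s : Fin (n + 2), ∑ t : Fin (n + 2),
        Complex.exp (Complex.I * (((s : ℕ) - (t : ℕ)) * φ)) * (lowerWeight p.1 s *
          B (p, lowerFreq p.1 s) (q, lowerFreq q.1 t) * lowerWeight q.1 t) =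
        lowerWeight p.1 s * ∑ t : Fin (n + 1),
          Complex.exp (Complex.I * (((s : ℕ) - (((t : ℕ) + (q.1 : ℕ) : ℕ) : ℂ)) * φ)) *
            B (p, lowerFreq p.1 s) (q, t) := by
      intro s
      rw [← sum_lowerWeight_mul q.1 (fun k t =>
        Complex.exp (Complex.I * (((s : ℕ) - (k : ℂ)) * φ)) * B (p, lowerFreq p.1 s) (q, t)),
        Finset.mul_sum]
      refine Finset.sum_congr rfl fun t _ => ?_
      ring
    simp only [hF]
    rw [sum_lowerWeight_mul p.1 (fun k s => ∑ t : Fin (n + 1),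
          Complex.exp (Complex.I * (((k : ℕ) - (((t : ℕ) + (q.1 : ℕ) : ℕ) : ℂ)) * φ)) *
            B (p, s) (q, t)), Finset.mul_sum]
    refine Finset.sum_congr rfl fun s _ => ?_
    rw [Finset.mul_sum]
    refine Finset.sum_congr rfl fun t _ => ?_
    rw [← mul_assoc, ← Complex.exp_add]
    congr 2
    push_cast
    ring

theorem AdaptiveStorage.isCoherent {N : ℕ} {M : Type} [Fintype M] [DecidableEq M]
    {σ : ℝ → Matrix M M ℂ} (hσ : AdaptiveStorage N σ) : IsCoherent (N + 1) σ := by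
  induction hσ with
  | prepare ρ hρ =>
    refine ⟨ρ.submatrix Prod.fst Prod.fst, ⟨hρ.1.submatrix _, ?_⟩, fun φ => ?_⟩
    · rw [← hρ.2]
      simp [Matrix.trace, Fintype.sum_prod_type]
    · ext i j
      simp [block]
  | use σ Φ _ hΦ ih => exact ih.phaseGate.channel hΦ

theorem ParallelStorage.isCoherent {N : ℕ} {M : Type} [Fintype M]
    {σ : ℝ → Matrix M M ℂ} (hσ : ParallelStorage N σ) : IsCoherent (N + 1) σ := by
  obtain ⟨A, _, _, ρ, Φ, hρ, hΦ, h⟩ := hσ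
  have key : IsCoherent (N + 1) fun φ =>
      conjMap (phaseGatePow N φ ⊗ₖ (1 : Matrix A A ℂ)) ρ := by
    -- A string carries the single frequency equal to its weight.
    refine ⟨_, ⟨posSemidef_weighted_submatrix hρ.1 Prod.fst
      (fun p : ((Fin N → Fin 2) × A) × Fin (N + 1) => if weight p.1.1 = p.2 then 1 else 0), ?_⟩, fun φ => ?_⟩
    · refine Eq.trans ?_ hρ.2
      simp only [Matrix.trace, Matrix.diag, Matrix.of_apply,
        Fintype.sum_prod_type (α₁ := (Fin N → Fin 2) × A)]
      refine Finset.sum_congr rfl fun p _ => ?_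
      rw [Finset.sum_eq_single (⟨weight p.1, weight_lt _⟩ : Fin (N + 1))]
      · simp
      · intro t _ ht
        rw [if_neg (fun h => ht (Fin.ext h.symm))]
        simp
      · simp
    · ext p q
      beta_reduce
      rw [phaseGatePow_eq_diagonal, ← Matrix.diagonal_one, Matrix.diagonal_kronecker_diagonal,
        conjMap_diagonal_apply]
      simp only [Matrix.sum_apply, Matrix.smul_apply, block, Matrix.of_apply, smul_eq_mul]
      rw [Finset.sum_eq_single (⟨weight p.1, weight_lt _⟩ : Fin (N + 1)),
        Finset.sum_eq_single (⟨weight q.1, weight_lt _⟩ : Fin (N + 1))]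
      · have := exp_mul_star_exp (weight p.1 * φ) (weight q.1 * φ)
        push_cast at this
        simp only [mul_one, if_true, star_one, one_mul, sub_mul]
        rw [← this]
        ring
      · intro t _ ht
        rw [if_neg (c := weight q.1 = t) (fun h => ht (Fin.ext h.symm))]
        simp
      · simp
      · intro t _ ht
        rw [if_neg (c := weight p.1 = t) (fun h => ht (Fin.ext h.symm))]
        simp
      · simp
  convert key.channel hΦ using 2 with φ
  exact h φ

/-! ### Optimality -/

/-- A linear identity on `2 × 2` matrices that holds for all qubit states holds everywhere. -/
theorem eq_zero_of_forall_isState {V : Type*} [AddCommGroup V] [Module ℂ V]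
    (f : Matrix (Fin 2) (Fin 2) ℂ →ₗ[ℂ] V) (hf : ∀ ξ, IsState ξ → f ξ = 0) : f = 0 := by
  have hu : ∀ u : Fin 2 → ℂ, f (Matrix.vecMulVec u (star u)) = 0 := by
    intro u
    by_cases h : u = 0
    · simp [h]
    have hpos := Matrix.posSemidef_vecMulVec_self_star u
    have hne : (Matrix.vecMulVec u (star u)).trace ≠ 0 := by
      rwa [Matrix.trace_vecMulVec, Ne, dotProduct_self_star_eq_zero]
    have h0 := hf ((Matrix.vecMulVec u (star u)).trace⁻¹ • Matrix.vecMulVec u (star u))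
      ⟨hpos.smul (inv_nonneg_of_nonneg hpos.trace_nonneg), by
        rw [Matrix.trace_smul, smul_eq_mul, inv_mul_cancel₀ hne]⟩
    rw [map_smul] at h0
    exact (smul_eq_zero.mp h0).resolve_left (inv_ne_zero hne)
  ext1 X
  -- Polarization: the projectors on `|0⟩`, `|1⟩`, `|0⟩ + |1⟩` and `|0⟩ + i|1⟩`, up to
  -- normalization, span the matrices.
  have hX : X = (X 0 0 - (X 0 1 + X 1 0) / 2 - Complex.I * (X 0 1 - X 1 0) / 2) •
        Matrix.vecMulVec ![1, 0] (star ![1, 0]) +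
      (X 1 1 - (X 0 1 + X 1 0) / 2 - Complex.I * (X 0 1 - X 1 0) / 2) •
        Matrix.vecMulVec ![0, 1] (star ![0, 1]) +
      ((X 0 1 + X 1 0) / 2) • Matrix.vecMulVec ![1, 1] (star ![1, 1]) +
      (Complex.I * (X 0 1 - X 1 0) / 2) •
        Matrix.vecMulVec ![1, Complex.I] (star ![1, Complex.I]) := by
    ext i j
    simp only [Matrix.add_apply, Matrix.smul_apply, Matrix.vecMulVec_apply, Pi.star_apply,
      smul_eq_mul]
    fin_cases i <;> fin_cases j <;> simp <;> ring_nf <;> simp [Complex.I_sq] <;> ring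
  rw [hX]
  simp only [map_add, map_smul, hu, smul_zero, add_zero, LinearMap.zero_apply]

/-- The Kronecker product with a qubit operator, as a bilinear map. -/
noncomputable def kroneckerLinear (M : Type) : Matrix (Fin 2) (Fin 2) ℂ →ₗ[ℂ] Matrix M M ℂ →ₗ[ℂ]
    Matrix (Fin 2 × M) (Fin 2 × M) ℂ :=
  Matrix.kroneckerMapBilinear (LinearMap.mul ℂ ℂ)

theorem kroneckerLinear_apply {M : Type} (ξ : Matrix (Fin 2) (Fin 2) ℂ) (X : Matrix M M ℂ) :
    kroneckerLinear M ξ X = ξ ⊗ₖ X := rfl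

/-- Exactness extends linearly from states to matrix units, which the diagonal `U_φ` only multiplies
by a phase. -/
theorem retrieved_entry {M : Type} [Fintype M] {σ : ℝ → Matrix M M ℂ}
    {Rs Rf : Matrix (Fin 2 × M) (Fin 2 × M) ℂ →ₗ[ℂ] Matrix (Fin 2) (Fin 2) ℂ} {p : ℝ}
    (hR : RetrievesWithProbability σ Rs Rf p) (φ : ℝ) (c d : Fin 2) :
    Rs (Matrix.single c d 1 ⊗ₖ σ φ) c d =
      p * Complex.exp (Complex.I * (((c : ℕ) - (d : ℕ)) * φ)) := by
  have h := eq_zero_of_forall_isState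
    (Rs ∘ₗ (kroneckerLinear M).flip (σ φ) - (p : ℂ) • conjMap (phaseGate φ))
    (fun ξ hξ => by
      simpa [sub_eq_zero, conjMap, kroneckerLinear_apply] using hR.2 φ ξ hξ)
  have h1 := congrFun (congrFun (LinearMap.congr_fun h (Matrix.single c d 1)) c) d
  rw [phaseGate_eq_diagonal] at h1
  simp only [LinearMap.sub_apply, LinearMap.smul_apply, LinearMap.comp_apply,
    Matrix.sub_apply, Matrix.smul_apply, conjMap_diagonal_apply, LinearMap.zero_apply,
    Matrix.zero_apply, sub_eq_zero, smul_eq_mul, Matrix.single_apply_same, mul_one] at h1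
  have h2 := exp_mul_star_exp ((c : ℕ) * φ) ((d : ℕ) * φ)
  push_cast at h2
  rw [sub_mul, ← h2]
  exact h1

/-- The matrix `⟨c| Rs(|c⟩⟨d| ⊗ B_{st}) |d⟩`, of which the retrieving instrument makes a Gram
matrix. -/
def retrievalGram {M T : Type} [Fintype M]
    (Rs : Matrix (Fin 2 × M) (Fin 2 × M) ℂ →ₗ[ℂ] Matrix (Fin 2) (Fin 2) ℂ)
    (B : Matrix (M × T) (M × T) ℂ) : Matrix (Fin 2 × T) (Fin 2 × T) ℂ :=
  Matrix.of fun p q => Rs (Matrix.single p.1 q.1 1 ⊗ₖ block B p.2 q.2) p.1 q.1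

/-- Apply `Rs ⊗ id` to `B` tensored with an unnormalized maximally entangled state of the input
qubit and a reference copy, then keep the entries whose output label equals the reference label. -/
theorem posSemidef_retrievalGram {M T : Type} [Fintype M] [Fintype T]
    {Rs : Matrix (Fin 2 × M) (Fin 2 × M) ℂ →ₗ[ℂ] Matrix (Fin 2) (Fin 2) ℂ}
    (hRs : IsCompletelyPositive Rs) {B : Matrix (M × T) (M × T) ℂ} (hB : B.PosSemidef) :
    (retrievalGram Rs B).PosSemidef := by
  have h := (hRs.posSemidef_of_fintype (posSemidef_weighted_submatrix hB
    (fun x : (Fin 2 × M) × (Fin 2 × T) => (x.1.2, x.2.2))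
    (fun x => if x.1.1 = x.2.1 then 1 else 0))).submatrix (fun p : Fin 2 × T => (p.1, p))
  convert h using 1
  ext ⟨c, s⟩ ⟨d, t⟩
  simp only [retrievalGram, Matrix.of_apply, Matrix.submatrix_apply]
  refine congrFun (congrFun (congrArg Rs ?_) c) d
  ext ⟨i, m⟩ ⟨j, n⟩
  simp only [Matrix.kroneckerMap_apply, Matrix.single_apply, block, Matrix.of_apply]
  by_cases hi : c = i <;> by_cases hj : d = j <;> simp [hi, hj, eq_comm (b := c), eq_comm (b := d)]

/-- A diagonal entry is at most the trace of the success output, and the failure output has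
nonnegative trace. -/
theorem retrievalGram_diag_le {M T : Type} [Fintype M] [Fintype T]
    {Rs Rf : Matrix (Fin 2 × M) (Fin 2 × M) ℂ →ₗ[ℂ] Matrix (Fin 2) (Fin 2) ℂ}
    (hR : IsInstrument Rs Rf) {B : Matrix (M × T) (M × T) ℂ} (hB : B.PosSemidef)
    (c : Fin 2) (t : T) :
    (retrievalGram Rs B (c, t) (c, t)).re ≤ (block B t t).trace.re := by
  classical
  have hblock : (block B t t).PosSemidef := hB.submatrix (fun m : M => (m, t))
  have hE : (Matrix.single c c (1 : ℂ)).PosSemidef := by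
    convert Matrix.posSemidef_vecMulVec_self_star (Pi.single c (1 : ℂ)) using 1
    rw [← Pi.single_star, star_one, Matrix.single_eq_single_vecMulVec_single]
  have hX := hE.kronecker hblock
  have hs := hR.1.posSemidef hX
  have hf := (hR.2.1.posSemidef hX).trace_nonneg
  have htr := hR.2.2 (Matrix.single c c 1 ⊗ₖ block B t t)
  rw [LinearMap.add_apply, Matrix.trace_add, Matrix.trace_kronecker, Matrix.trace_single_eq_same,
    one_mul] at htr
  have hle : Rs (Matrix.single c c 1 ⊗ₖ block B t t) c c ≤
      (Rs (Matrix.single c c 1 ⊗ₖ block B t t)).trace :=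
    Finset.single_le_sum (f := fun i => Rs (Matrix.single c c 1 ⊗ₖ block B t t) i i)
      (fun i _ => hs.diag_nonneg) (Finset.mem_univ c)
  have : Rs (Matrix.single c c 1 ⊗ₖ block B t t) c c ≤ (block B t t).trace := by
    rw [← htr]
    exact hle.trans (le_add_of_nonneg_right hf)
  exact (Complex.le_def.mp this).1

theorem IsCoherent.success_le {N : ℕ} {M : Type} [Fintype M] {σ : ℝ → Matrix M M ℂ}
    (hσ : IsCoherent (N + 1) σ)
    {Rs Rf : Matrix (Fin 2 × M) (Fin 2 × M) ℂ →ₗ[ℂ] Matrix (Fin 2) (Fin 2) ℂ} {p : ℝ}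
    (hR : RetrievesWithProbability σ Rs Rf p) : p ≤ (N : ℝ) / ((N : ℝ) + 1) := by
  obtain ⟨B, hB, h⟩ := hσ
  have hg := posSemidef_retrievalGram hR.1.1 hB.1
  have hfourier : ∀ (c d : Fin 2) (φ : ℝ), ∑ s : Fin (N + 1), ∑ t : Fin (N + 1),
      Complex.exp (Complex.I * (((s : ℕ) - (t : ℕ)) * φ)) * retrievalGram Rs B (c, s) (d, t) =
      p * Complex.exp (Complex.I * (((c : ℕ) - (d : ℕ)) * φ)) := by
    intro c d φ
    rw [← retrieved_entry hR, h]
    have hlin : ∀ X, Rs (Matrix.single c d 1 ⊗ₖ X) =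
      (Rs ∘ₗ kroneckerLinear M (Matrix.single c d 1)) X := fun X => rfl
    rw [hlin]
    simp only [map_sum, map_smul, Matrix.sum_apply, Matrix.smul_apply, smul_eq_mul]
    rfl
  have hdiag : ∀ c : Fin 2, ∑ t, (retrievalGram Rs B (c, t) (c, t)).re = p := by
    intro c
    have := sum_diagonal_eq (fun s t => retrievalGram Rs B (c, s) (c, t)) p
      (fun φ => by simpa using hfourier c c φ)
    simpa using congrArg Complex.re this
  have hsub : ∑ s : Fin N, (retrievalGram Rs B (1, s.succ) (0, s.castSucc)).re = p := by
    have := sum_subdiagonal_eq (fun s t => retrievalGram Rs B (1, s) (0, t)) p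
      (fun φ => by simpa using hfourier 1 0 φ)
    simpa using congrArg Complex.re this
  have htrace : ∑ t, (block B t t).trace.re = 1 := by
    have := congrArg Complex.re hB.2
    simpa [Matrix.trace, Fintype.sum_prod_type_right, block] using this
  -- The compared indices are `(0, s)` and `(1, s + 1)`: the input `|1⟩` must gain one unit of
  -- frequency over `|0⟩`.
  exact success_le_of_shift htrace (fun t => (Complex.nonneg_iff.mp hg.diag_nonneg).1)
    (fun t => (Complex.nonneg_iff.mp hg.diag_nonneg).1)
    (retrievalGram_diag_le hR.1 hB.1 0) (retrievalGram_diag_le hR.1 hB.1 1)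
    (fun s => (re_entry_le_of_posSemidef hg _ _).1) (fun s => (re_entry_le_of_posSemidef hg _ _).2)
    (hdiag 0) (hdiag 1) hsub

theorem isState_single {m : Type} [Fintype m] [DecidableEq m] (i : m) :
    IsState (Matrix.single i i (1 : ℂ)) := by
  convert isState_vecMulVec (u := Pi.single i (1 : ℂ)) (by simp) using 1
  rw [← Pi.single_star, star_one, Matrix.single_eq_single_vecMulVec_single]

end PhaseGatePSR

open PhaseGatePSR
theorem theorem1 (N : ℕ) :
    IsGreatest (adaptiveSuccessProbabilities N) ((N : ℝ) / ((N : ℝ) + 1)) ∧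
    IsGreatest (parallelSuccessProbabilities N) ((N : ℝ) / ((N : ℝ) + 1)) ∧
    (∃ v : Fin (N + 1) → (Fin N → Fin 2) → ℂ, IsIrrepFamily N v) ∧
    ∀ (v : Fin (N + 1) → (Fin N → Fin 2) → ℂ) (τ : Matrix (Fin (N + 1)) (Fin (N + 1)) ℂ),
      IsIrrepFamily N v → IsState τ →
      AdaptiveStorage N (quditStored N v τ) ∧
      ParallelStorage N (quditStored N v τ) ∧
      RetrievesWithProbability (quditStored N v τ) (shiftDownSuccess N) (shiftDownFailure N)
        ((N : ℝ) / ((N : ℝ) + 1)) := by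
  obtain ⟨v, hv⟩ := exists_isIrrepFamily N
  have hτ := isState_single (0 : Fin (N + 1))
  refine ⟨⟨⟨_, _, _, _, _, _, adaptiveStorage_quditStored hv _,
    retrievesWithProbability_quditStored hv (Matrix.single 0 0 1)⟩, ?_⟩,
    ⟨⟨_, _, _, _, _, parallelStorage_quditStored hv hτ,
      retrievesWithProbability_quditStored hv _⟩, ?_⟩, ⟨v, hv⟩, fun v τ hv hτ =>
    ⟨adaptiveStorage_quditStored hv τ, parallelStorage_quditStored hv hτ,
      retrievesWithProbability_quditStored hv τ⟩⟩
  · rintro p ⟨M, _, _, σ, Rs, Rf, hσ, hR⟩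
    exact hσ.isCoherent.success_le hR
  · rintro p ⟨M, _, σ, Rs, Rf, hσ, hR⟩
    exact hσ.isCoherent.success_le hR
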